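/- Call an integral domain a Prüfer domain if each of its nonzero finitely generated ideals is invertible (fields are allowed), and call an ultrafilter $\mathcal F$ on a set $\Lambda$ countably incomplete if there is a partition $\Lambda=\bigcup_{n\in\mathbb N}P_n$ into pairwise disjoint (possibly empty) sets with $P_n\notin\mathcal F$ for every $n$. Let $\Lambda$ be an infinite set and let $(D_\lambda)_{\lambda\in\Lambda}$ be a family of Prüfer domains, each having only finitely many maximal ideals, such that for some $N\in\mathbb N$ we have $|\max(D_\lambda)|\le N$ for all $\lambda\in\Lambda$. Put $R=\prod_{\lambda\in\Lambda}D_\lambda$. For an ultrafilter $\mathcal F$ on $\Lambda$ let $(0)_{\mathcal F}=\{x\in R : \{\lambda : x_\lambda=0\}\in\mathcal F\}$, and let $R^*=\prod^{\mathcal F}_{\lambda\in\Lambda}D_\lambda$ be the ultraproduct, i.e. the quotient ring of $R$ in which $r,s\in R$ are identified if and only if $\{\lambda : r_\lambda=s_\lambda\}\in\mathcal F$. Then there exists a countably incomplete ultrafilter on $\Lambda$, and for every countably incomplete ultrafilter $\mathcal F$ on $\Lambda$ the following hold. 1. Every non-minimal prime ideal of $R$ containing $(0)_{\mathcal F}$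 has infinite height. 2. $R^*$ is a Prüfer domain. 3. Every nonzero prime ideal of $R^*$ has infinite height. 4. If every $D_\lambda$ is local, then $R^*$ is a valuation domain. 5. If every $D_\lambda$ is non-local, then $R^*$ is non-local. 6. If no $D_\lambda$ is a field, then $R^*$ is not a field (so that statement 3 is not vacuous). Here "local" means having exactly one maximal ideal (no Noetherian hypothesis), and a prime ideal has infinite height if there are chains of prime ideals of arbitrary finite length descending from it. -/

import Mathlib

open scoped nonZeroDivisors

universe u v

/-- A Prüfer domain: an integral domain in which every nonzero finitely generated ideal is
invertible (as a fractional ideal of the field of fractions). Fields are allowed. -/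
structure IsPruferDomain (D : Type v) [CommRing D] : Prop where
  isDomain : IsDomain D
  isUnit_of_fg : ∀ I : Ideal D, I.FG → I ≠ ⊥ →
    IsUnit (I : FractionalIdeal D⁰ (FractionRing D))

/-- An ultrafilter on `Λ` is countably incomplete if `Λ` is the union of countably many pairwise
disjoint sets, none of which belongs to the ultrafilter. -/
def IsCountablyIncomplete {Λ : Type u} (F : Ultrafilter Λ) : Prop :=
  ∃ P : ℕ → Set Λ, (∀ n, P n ∉ F) ∧ (⋃ n, P n) = Set.univ ∧
    ∀ m n, m ≠ n → P m ∩ P n = ∅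

section Ultraproduct

variable {Λ : Type u} (F : Ultrafilter Λ) (D : Λ → Type v) [∀ l, CommRing (D l)]

/-- The congruence on `∏ D_λ` that identifies `r` and `s` when `{λ | r_λ = s_λ}` belongs to the
ultrafilter. -/
def ultraproductCon : RingCon (∀ l, D l) where
  r := fun r s => {l | r l = s l} ∈ F
  iseqv :=
    { refl := fun r => Filter.Eventually.of_forall fun _ => rfl
      symm := fun {r s} h => by
        filter_upwards [h] with l hl using hl.symm
      trans := fun {r s t} h h' => by
        filter_upwards [h, h'] with l hl hl' using hl.trans hl' }
  add' := fun {a b c d} h h' => by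
    filter_upwards [h, h'] with l hl hl'
    have e : a l = b l := hl
    have e' : c l = d l := hl'
    change a l + c l = b l + d l
    rw [e, e']
  mul' := fun {a b c d} h h' => by
    filter_upwards [h, h'] with l hl hl'
    have e : a l = b l := hl
    have e' : c l = d l := hl'
    change a l * c l = b l * d l
    rw [e, e']

/-- The ultraproduct of the rings `D_λ` with respect to `F`. -/
abbrev RingUltraproduct : Type (max u v) := (ultraproductCon F D).Quotient

/-- The ideal `(0)_F` of `∏ D_λ`: all `x` with `{λ | x_λ = 0}` in `F`. -/
def zeroIdeal : Ideal (∀ l, D l) where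
  carrier := {x | {l | x l = 0} ∈ F}
  zero_mem' := Filter.Eventually.of_forall fun _ => rfl
  add_mem' := fun {a b} h h' => by
    filter_upwards [h, h'] with l hl hl'
    have e : a l = 0 := hl
    have e' : b l = 0 := hl'
    change a l + b l = 0
    rw [e, e', add_zero]
  smul_mem' := fun c x h => by
    filter_upwards [h] with l hl
    have e : x l = 0 := hl
    change c l * x l = 0
    rw [e, mul_zero]

end Ultraproduct

/-! Invertible ideals of a semilocal domain are principal, so each `D l` is Bézout. Gcds and Bézout
coefficients can be chosen coordinatewise, so the product is Bézout, and so is its quotient, the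
ultraproduct; a Bézout domain is Prüfer, and a local one is a valuation domain.

Infinite height comes from countable incompleteness: it yields `g : Λ → ℕ` that is `F`-almost
everywhere at least any given `k`, so `x ^ g`, taken coordinatewise, is nonzero modulo `zeroIdeal F
D` yet divisible there by every power of `x`. Such elements forbid a smallest step above `zeroIdeal
F D`, so chains descend forever. The remaining claims hold because being a unit is tested `F`-almost
everywhere. -/

/-- If every prime in a class of primes strictly contains another prime of that class, all of them
have infinite height. -/
theorem Ideal.height_eq_top_of_forall_exists_lt {A : Type u} [CommRing A]
    (S : PrimeSpectrum A → Prop) (h : ∀ p, S p → ∃ q, S q ∧ q < p)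
    (p : PrimeSpectrum A) (hp : S p) : p.asIdeal.height = ⊤ := by
  rw [PrimeSpectrum.height_eq_orderHeight, ENat.eq_top_iff_forall_ge]
  intro n
  induction n generalizing p with
  | zero => simp
  | succ n ih =>
    obtain ⟨q, hq, hqp⟩ := h p hp
    calc ((n + 1 : ℕ) : ℕ∞) = n + 1 := by push_cast; rfl
      _ ≤ Order.height q + 1 := by gcongr; exact ih q hq
      _ ≤ Order.height p := Order.height_add_one_le hqp

/-- Let `I` be a prime ideal such that modulo `I` every nonzero element `x` has a nonzero `d`
divisible by all powers of `x`. Then a prime strictly above `I` contains another one. -/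
theorem Ideal.exists_isPrime_between_of_dvd_pow {A : Type u} [CommRing A] {I P : Ideal A}
    [I.IsPrime] [P.IsPrime] (hIP : I < P)
    (h : ∀ x ∉ I, ∃ d ∉ I, ∀ k : ℕ, ∃ e, d - x ^ k * e ∈ I) :
    ∃ Q : Ideal A, Q.IsPrime ∧ I < Q ∧ Q < P := by
  obtain ⟨x, hxP, hxI⟩ := SetLike.exists_of_lt hIP
  obtain ⟨d, hdI, hd⟩ := h x hxI
  -- A prime containing `I` and `d` that avoids this monoid lies inside `P` and misses `x`.
  have hdisj : Disjoint ((I ⊔ Ideal.span {d} : Ideal A) : Set A)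
      (P.primeCompl ⊔ Submonoid.powers x : Submonoid A) := by
    rw [Set.disjoint_left]
    intro y hy hyS
    obtain ⟨s, hs, _, ⟨k, rfl⟩, rfl⟩ := Submonoid.mem_sup.1 hyS
    obtain ⟨i, hi, _, hr, hsum⟩ := Submodule.mem_sup.1 hy
    obtain ⟨r, rfl⟩ := Ideal.mem_span_singleton'.1 hr
    -- One power more than `k`: after cancelling `x ^ k` modulo `I`, the spare factor `x` would
    -- force `s` into `P`.
    obtain ⟨e, he⟩ := hd (k + 1)
    have hmem : x ^ k * (s - x * (e * r)) ∈ I := by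
      have := I.add_mem hi (I.mul_mem_left r he)
      convert this using 1
      linear_combination -hsum
    rcases Ideal.IsPrime.mem_or_mem ‹I.IsPrime› hmem with h1 | h1
    · exact hxI (Ideal.IsPrime.mem_of_pow_mem ‹I.IsPrime› k h1)
    · exact hs ((P.sub_mem_iff_left (P.mul_mem_right _ hxP)).1 (hIP.le h1))
  obtain ⟨Q, hQ, hle, hQS⟩ := Ideal.exists_le_prime_disjoint _ _ hdisj
  rw [Set.disjoint_left] at hQS
  have hdQ : d ∈ Q := hle (Ideal.mem_sup_right (Ideal.mem_span_singleton_self d))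
  refine ⟨Q, hQ, lt_of_le_of_ne (le_sup_left.trans hle) ?_, lt_of_le_of_ne ?_ ?_⟩
  · rintro rfl
    exact hdI hdQ
  · intro y hy
    by_contra hyP
    exact hQS hy (Submonoid.mem_sup_left hyP)
  · rintro rfl
    exact hQS hxP (Submonoid.mem_sup_right (Submonoid.mem_powers x))

theorem Ideal.height_eq_top_of_dvd_pow {A : Type u} [CommRing A] {I P : Ideal A}
    [I.IsPrime] [hP : P.IsPrime] (hIP : I < P)
    (h : ∀ x ∉ I, ∃ d ∉ I, ∀ k : ℕ, ∃ e, d - x ^ k * e ∈ I) : P.height = ⊤ := by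
  refine Ideal.height_eq_top_of_forall_exists_lt (fun p => I < p.asIdeal) ?_ ⟨P, hP⟩ hIP
  intro p hp
  obtain ⟨Q, hQ, hIQ, hQp⟩ := Ideal.exists_isPrime_between_of_dvd_pow hp h
  exact ⟨⟨Q, hQ⟩, hIQ, hQp⟩

/-! ### Prüfer and Bézout domains -/

theorem IsPruferDomain.isBezout {D : Type v} [CommRing D] (h : IsPruferDomain D)
    [Finite (MaximalSpectrum D)] : IsBezout D := by
  have := h.isDomain
  refine ⟨fun I hI => ?_⟩
  by_cases hI0 : I = ⊥
  · subst hI0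
    infer_instance
  have hfin : {I : Ideal D | I.IsMaximal}.Finite := by
    refine (Set.finite_range (MaximalSpectrum.asIdeal (R := D))).subset ?_
    exact fun J hJ => ⟨⟨J, hJ⟩, rfl⟩
  exact Ideal.IsPrincipal.of_finite_maximals_of_isUnit hfin (h.isUnit_of_fg I hI hI0)

theorem IsPruferDomain.of_isBezout (D : Type v) [CommRing D] [hD : IsDomain D] [IsBezout D] :
    IsPruferDomain D := by
  refine ⟨hD, fun I hI hI0 => ?_⟩
  obtain ⟨a, rfl⟩ := (IsBezout.isPrincipal_of_FG I hI).principal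
  rw [Ideal.submodule_span_eq] at hI0 ⊢
  have ha : algebraMap D (FractionRing D) a ≠ 0 := by
    rw [Ne, FaithfulSMul.algebraMap_eq_zero_iff]
    rintro rfl
    simp at hI0
  rw [FractionalIdeal.coeIdeal_span_singleton]
  exact .of_mul_eq_one _ (FractionalIdeal.spanSingleton_mul_inv (R₁ := D) _ ha)

theorem IsBezout.pi {ι : Type u} (D : ι → Type v) [∀ i, CommRing (D i)] [∀ i, IsBezout (D i)] :
    IsBezout (∀ i, D i) := by
  rw [IsBezout.iff_span_pair_isPrincipal]
  intro x y
  choose u v huv using fun i => IsBezout.gcd_eq_sum (x i) (y i)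
  choose a ha using fun i => IsBezout.gcd_dvd_left (x i) (y i)
  choose b hb using fun i => IsBezout.gcd_dvd_right (x i) (y i)
  refine ⟨⟨fun i => IsBezout.gcd (x i) (y i), ?_⟩⟩
  rw [Ideal.submodule_span_eq]
  apply le_antisymm
  · rw [Ideal.span_le, Set.insert_subset_iff, Set.singleton_subset_iff]
    simp only [SetLike.mem_coe, Ideal.mem_span_singleton]
    exact ⟨⟨a, funext ha⟩, ⟨b, funext hb⟩⟩
  · rw [Ideal.span_singleton_le_iff_mem, Ideal.mem_span_pair]
    exact ⟨u, v, funext huv⟩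

/-! ### Countably incomplete ultrafilters -/

theorem exists_isCountablyIncomplete (Λ : Type u) [Infinite Λ] :
    ∃ F : Ultrafilter Λ, IsCountablyIncomplete F := by
  let f := Infinite.natEmbedding Λ
  -- A nonprincipal ultrafilter on `ℕ` is pushed forward along `f`. The default value of `invFun`
  -- off the range of `f` is harmless: its fibres still partition `Λ`.
  refine ⟨(Filter.hyperfilter ℕ).map f, fun n => Function.invFun f ⁻¹' {n}, fun n => ?_, ?_, ?_⟩
  · rw [Ultrafilter.mem_map, ← Set.preimage_comp, Function.invFun_comp f.injective]
    exact Filter.notMem_hyperfilter_of_finite (Set.finite_singleton n)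
  · rw [← Set.preimage_iUnion, Set.iUnion_of_singleton, Set.preimage_univ]
  · intro m n hmn
    rw [← Set.preimage_inter, Set.singleton_inter_eq_empty.2 (by simpa using hmn),
      Set.preimage_empty]

/-- Take `g l` to be the index of a piece containing `l`; `g l < k` confines `l` to finitely many
pieces outside `F`. -/
theorem IsCountablyIncomplete.exists_eventually_le {Λ : Type u} {F : Ultrafilter Λ}
    (hF : IsCountablyIncomplete F) : ∃ g : Λ → ℕ, ∀ k, ∀ᶠ l in (F : Filter Λ), k ≤ g l := by
  obtain ⟨P, hP, hU, -⟩ := hF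
  have hex : ∀ l, ∃ n, l ∈ P n := fun l => Set.mem_iUnion.1 (hU ▸ Set.mem_univ l)
  choose g hg using hex
  refine ⟨g, fun k => ?_⟩
  have h : ∀ i ∈ Finset.range k, ∀ᶠ l in (F : Filter Λ), l ∉ P i :=
    fun i _ => Ultrafilter.compl_mem_iff_notMem.2 (hP i)
  filter_upwards [(Filter.eventually_all_finset _).2 h] with l hl
  by_contra hlt
  exact hl (g l) (Finset.mem_range.2 (not_le.1 hlt)) (hg l)

/-! ### Transfer to the ultraproduct -/

section Ultraproduct

variable {Λ : Type u} (F : Ultrafilter Λ) (D : Λ → Type v) [∀ l, CommRing (D l)]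

theorem mem_zeroIdeal {x : ∀ l, D l} :
    x ∈ zeroIdeal F D ↔ ∀ᶠ l in (F : Filter Λ), x l = 0 := Iff.rfl

theorem zeroIdeal_isPrime [∀ l, IsDomain (D l)] : (zeroIdeal F D).IsPrime := by
  refine ⟨fun h => ?_, fun {x y} hxy => ?_⟩
  · have h1 := (mem_zeroIdeal F D).1 ((Ideal.eq_top_iff_one _).1 h)
    obtain ⟨l, hl⟩ := h1.exists
    exact one_ne_zero hl
  · simp only [mem_zeroIdeal] at hxy ⊢
    rw [← Ultrafilter.eventually_or]
    filter_upwards [hxy] with l hl using mul_eq_zero.1 hl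

theorem zeroIdeal_mem_minimalPrimes [∀ l, IsDomain (D l)] :
    zeroIdeal F D ∈ minimalPrimes (∀ l, D l) := by
  classical
  refine ⟨⟨zeroIdeal_isPrime F D, bot_le⟩, fun Q hQ hQI x hx => ?_⟩
  have hQp : Q.IsPrime := hQ.1
  -- The idempotent supported where `x` is nonzero. A prime contains `e` or `1 - e`, and `1 - e`
  -- equals `1` on an `F`-large set, so it is not in `zeroIdeal F D`.
  let e : ∀ l, D l := fun l => if x l = 0 then 0 else 1
  have hprod : e * (1 - e) ∈ Q := by
    convert Q.zero_mem using 1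
    ext l
    by_cases h : x l = 0 <;> simp [e, h]
  have hxe : x = e * x := by
    ext l
    by_cases h : x l = 0 <;> simp [e, h]
  rcases hQp.mem_or_mem hprod with h | h
  · rw [hxe]
    exact Q.mul_mem_right _ h
  · obtain ⟨l, hl, hl'⟩ := (((mem_zeroIdeal F D).1 hx).and ((mem_zeroIdeal F D).1 (hQI h))).exists
    simp [e, hl] at hl'

theorem exists_dvd_pow_of_isCountablyIncomplete [∀ l, IsDomain (D l)]
    (hF : IsCountablyIncomplete F) (x : ∀ l, D l) (hx : x ∉ zeroIdeal F D) :
    ∃ d ∉ zeroIdeal F D, ∀ k : ℕ, ∃ e, d - x ^ k * e ∈ zeroIdeal F D := by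
  obtain ⟨g, hg⟩ := hF.exists_eventually_le
  -- The truncated exponent `g l - k` is wrong only where `g l < k`, which is `F`-negligible.
  refine ⟨fun l => x l ^ g l, ?_, fun k => ⟨fun l => x l ^ (g l - k), ?_⟩⟩
  · intro h
    apply hx
    rw [mem_zeroIdeal] at h ⊢
    filter_upwards [h] with l hl using eq_zero_of_pow_eq_zero hl
  · rw [mem_zeroIdeal]
    filter_upwards [hg k] with l hl
    simp [← pow_add, Nat.add_sub_cancel' hl]

/-- The projection of the product onto the ultraproduct. -/
abbrev ultraproductMk : (∀ l, D l) →+* RingUltraproduct F D := (ultraproductCon F D).mk'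

theorem ultraproductMk_surjective : Function.Surjective (ultraproductMk F D) :=
  (ultraproductCon F D).mk'_surjective

theorem ultraproductMk_eq_iff {x y : ∀ l, D l} :
    ultraproductMk F D x = ultraproductMk F D y ↔ ∀ᶠ l in (F : Filter Λ), x l = y l :=
  RingCon.eq _

theorem ultraproductMk_eq_zero_iff {x : ∀ l, D l} :
    ultraproductMk F D x = 0 ↔ x ∈ zeroIdeal F D := by
  rw [← map_zero (ultraproductMk F D), ultraproductMk_eq_iff, mem_zeroIdeal]
  rfl

theorem isUnit_ultraproductMk_iff {x : ∀ l, D l} :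
    IsUnit (ultraproductMk F D x) ↔ ∀ᶠ l in (F : Filter Λ), IsUnit (x l) := by
  classical
  rw [isUnit_iff_exists_inv]
  constructor
  · rintro ⟨y, hy⟩
    obtain ⟨y, rfl⟩ := ultraproductMk_surjective F D y
    rw [← map_mul, ← map_one (ultraproductMk F D), ultraproductMk_eq_iff] at hy
    filter_upwards [hy] with l hl using .of_mul_eq_one _ hl
  · intro h
    refine ⟨ultraproductMk F D fun l => Ring.inverse (x l), ?_⟩
    rw [← map_mul, ← map_one (ultraproductMk F D), ultraproductMk_eq_iff]
    filter_upwards [h] with l hl using Ring.mul_inverse_cancel _ hl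

theorem ringUltraproduct_isDomain [∀ l, IsDomain (D l)] : IsDomain (RingUltraproduct F D) := by
  have hP := zeroIdeal_isPrime F D
  have : Nontrivial (RingUltraproduct F D) := by
    refine ⟨1, 0, fun h => hP.ne_top ((Ideal.eq_top_iff_one _).2 ?_)⟩
    rwa [← ultraproductMk_eq_zero_iff, map_one]
  have : NoZeroDivisors (RingUltraproduct F D) := by
    refine ⟨fun {a b} hab => ?_⟩
    obtain ⟨a, rfl⟩ := ultraproductMk_surjective F D a
    obtain ⟨b, rfl⟩ := ultraproductMk_surjective F D b
    rw [← map_mul] at hab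
    simp only [ultraproductMk_eq_zero_iff] at hab ⊢
    exact hP.mem_or_mem hab
  exact NoZeroDivisors.to_isDomain _

theorem height_eq_top_of_zeroIdeal_lt [∀ l, IsDomain (D l)] (hF : IsCountablyIncomplete F)
    (P : Ideal (∀ l, D l)) [P.IsPrime] (hP : zeroIdeal F D < P) : P.height = ⊤ :=
  have := zeroIdeal_isPrime F D
  Ideal.height_eq_top_of_dvd_pow hP (exists_dvd_pow_of_isCountablyIncomplete F D hF)

theorem ringUltraproduct_height_eq_top [∀ l, IsDomain (D l)] (hF : IsCountablyIncomplete F)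
    (P : Ideal (RingUltraproduct F D)) [P.IsPrime] (hP : P ≠ ⊥) : P.height = ⊤ := by
  have := ringUltraproduct_isDomain F D
  have : (⊥ : Ideal (RingUltraproduct F D)).IsPrime := Ideal.isPrime_bot
  refine Ideal.height_eq_top_of_dvd_pow (bot_lt_iff_ne_bot.2 hP) fun x hx => ?_
  obtain ⟨x, rfl⟩ := ultraproductMk_surjective F D x
  rw [Ideal.mem_bot, ultraproductMk_eq_zero_iff] at hx
  obtain ⟨d, hd, h⟩ := exists_dvd_pow_of_isCountablyIncomplete F D hF x hx
  refine ⟨ultraproductMk F D d, by rwa [Ideal.mem_bot, ultraproductMk_eq_zero_iff], fun k => ?_⟩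
  obtain ⟨e, he⟩ := h k
  refine ⟨ultraproductMk F D e, ?_⟩
  rwa [Ideal.mem_bot, ← map_pow, ← map_mul, ← map_sub, ultraproductMk_eq_zero_iff]

theorem ringUltraproduct_isBezout [∀ l, IsBezout (D l)] : IsBezout (RingUltraproduct F D) :=
  have := IsBezout.pi D
  (ultraproductMk_surjective F D).isBezout (ultraproductMk F D)

theorem ringUltraproduct_isLocalRing [∀ l, IsDomain (D l)] [∀ l, IsLocalRing (D l)] :
    IsLocalRing (RingUltraproduct F D) := by
  have := ringUltraproduct_isDomain F D
  refine IsLocalRing.of_isUnit_or_isUnit_one_sub_self fun x => ?_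
  obtain ⟨x, rfl⟩ := ultraproductMk_surjective F D x
  -- The ultrafilter property lets the coordinatewise alternative be decided once, `F`-almost
  -- everywhere.
  rw [← map_one (ultraproductMk F D), ← map_sub, isUnit_ultraproductMk_iff,
    isUnit_ultraproductMk_iff, ← Ultrafilter.eventually_or]
  exact .of_forall fun l => IsLocalRing.isUnit_or_isUnit_one_sub_self (x l)

theorem ringUltraproduct_not_isLocalRing [∀ l, Nontrivial (D l)] (h : ∀ l, ¬ IsLocalRing (D l)) :
    ¬ IsLocalRing (RingUltraproduct F D) := by
  intro hloc
  have hex : ∀ l, ∃ a : D l, ¬ (IsUnit a ∨ IsUnit (1 - a)) := fun l => by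
    by_contra! hc
    exact h l (.of_isUnit_or_isUnit_one_sub_self hc)
  choose a ha using hex
  have := IsLocalRing.isUnit_or_isUnit_one_sub_self (ultraproductMk F D a)
  rw [← map_one (ultraproductMk F D), ← map_sub, isUnit_ultraproductMk_iff,
    isUnit_ultraproductMk_iff, ← Ultrafilter.eventually_or] at this
  obtain ⟨l, hl⟩ := this.exists
  exact ha l hl

theorem ringUltraproduct_not_isField [∀ l, Nontrivial (D l)] (h : ∀ l, ¬ IsField (D l)) :
    ¬ IsField (RingUltraproduct F D) := by
  intro hfield
  have hex : ∀ l, ∃ a : D l, a ≠ 0 ∧ ¬ IsUnit a := fun l => by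
    obtain ⟨a, ha, hu⟩ := Ring.exists_not_isUnit_of_not_isField (h l)
    exact ⟨a, ha, hu⟩
  choose a ha hu using hex
  have hne : ultraproductMk F D a ≠ 0 := by
    rw [Ne, ultraproductMk_eq_zero_iff, mem_zeroIdeal]
    exact fun h0 => h0.exists.elim ha
  obtain ⟨b, hb⟩ := hfield.mul_inv_cancel hne
  obtain ⟨l, hl⟩ := ((isUnit_ultraproductMk_iff F D).1 (.of_mul_eq_one _ hb)).exists
  exact hu l hl

end Ultraproduct

theorem mainTheorem10 {Λ : Type u} [Infinite Λ] (D : Λ → Type v) [∀ l, CommRing (D l)]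
    (hPrufer : ∀ l, IsPruferDomain (D l))
    (hSemilocal : ∀ l, Finite (MaximalSpectrum (D l)))
    (hBound : ∃ N : ℕ, ∀ l, Nat.card (MaximalSpectrum (D l)) ≤ N) :
    (∃ F : Ultrafilter Λ, IsCountablyIncomplete F) ∧
    ∀ F : Ultrafilter Λ, IsCountablyIncomplete F →
      (∀ P : Ideal (∀ l, D l), P.IsPrime → zeroIdeal F D ≤ P →
        P ∉ minimalPrimes (∀ l, D l) → P.height = ⊤) ∧
      IsPruferDomain (RingUltraproduct F D) ∧
      (∀ P : Ideal (RingUltraproduct F D), P.IsPrime → P ≠ ⊥ → P.height = ⊤) ∧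
      ((∀ l, IsLocalRing (D l)) →
        ∃ _ : IsDomain (RingUltraproduct F D), ValuationRing (RingUltraproduct F D)) ∧
      ((∀ l, ¬ IsLocalRing (D l)) → ¬ IsLocalRing (RingUltraproduct F D)) ∧
      ((∀ l, ¬ IsField (D l)) → ¬ IsField (RingUltraproduct F D)) := by
  have hdom : ∀ l, IsDomain (D l) := fun l => (hPrufer l).isDomain
  have hbez : ∀ l, IsBezout (D l) := fun l => (hPrufer l).isBezout
  refine ⟨exists_isCountablyIncomplete Λ, fun F hF => ?_⟩
  have hdomU := ringUltraproduct_isDomain F D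
  have hbezU := ringUltraproduct_isBezout F D
  refine ⟨fun P hP hle hmin => ?_, .of_isBezout _, fun P hP hne => ?_, fun hloc => ⟨hdomU, ?_⟩,
    ringUltraproduct_not_isLocalRing F D, ringUltraproduct_not_isField F D⟩
  · refine height_eq_top_of_zeroIdeal_lt F D hF P (lt_of_le_of_ne hle ?_)
    rintro rfl
    exact hmin (zeroIdeal_mem_minimalPrimes F D)
  · exact ringUltraproduct_height_eq_top F D hF P hne
  · exact ValuationRing.iff_local_bezout_domain.2 ⟨ringUltraproduct_isLocalRing F D, hbezU⟩
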